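/- Let $\mathbb{H}$ be the quaternions and let $V$ be a right quaternionic Banach space (in particular, $V$ may be any right quaternionic Hilbert space $V_{\mathbb{H}}^R$): a complete normed space with a right multiplication by quaternions satisfying $\|\phi q\|=\|\phi\|\,|q|$. Let $B(V)$ be the set of bounded right $\mathbb{H}$-linear operators on $V$. For $A\in B(V)$ and $q\in\mathbb{H}$ put $$R_q(A)=A^2-2\,\mathrm{Re}(q)\,A+|q|^2 I,$$ and let $\sigma_S(A)$ be the set of all $q\in\mathbb{H}$ for which $R_q(A)$ has no inverse in $B(V)$. The operator $A$ is called decomposable if for any two open sets $U_1,U_2\subseteq\mathbb{H}$ with $U_1\cup U_2=\mathbb{H}$ there are closed $A$-invariant right linear subspaces $Y,Z\subseteq V$ with $\sigma_S(A|_Y)\subseteq U_1$, $\sigma_S(A|_Z)\subseteq U_2$ and $V=Y+Z$. Let $U\subseteq\mathbb{H}$ be open. A function $f:U\to V$ is right slice-regular if it has partial derivatives in the four real coordinates and if, for every $I\in\mathbb{H}$ with $\mathrm{Re}\,I=0$ and $|I|=1$, its restriction $f_I$ to $U\cap\mathbb{C}_I$, where $\mathbb{C}_I=\mathbb{R}+I\mathbb{R}$,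 has continuous partial derivatives in $x$ and $y$ and satisfies $$\frac12\left(\frac{\partial f_I}{\partial x}(x+yI)+\frac{\partial f_I}{\partial y}(x+yI)\,I\right)=0\qquad\text{for } x+yI\in U\cap\mathbb{C}_I.$$ The operator $A$ has Bishop's property $(\beta)$ if, for every open set $U\subseteq\mathbb{H}$ and every sequence of continuous right slice-regular functions $f_n:U\to V$ such that $R_q(A)f_n(q)\to 0$ uniformly on every compact subset of $U$, one has $f_n\to 0$ locally uniformly on $U$. Theorem. Every decomposable operator $A\in B(V)$ has Bishop's property $(\beta)$. -/

import Mathlib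

open scoped Quaternion MulOpposite

namespace QuaternionicOperator

/-!
A right quaternionic Banach space is a complete normed group `V` with a right action of the
quaternions (an action of `ℍ[ℝ]ᵐᵒᵖ`, where `MulOpposite.op q • φ` is `φ q`) such that
`‖φ q‖ = ‖φ‖ |q|` (`NormSMulClass`); its real structure is the restriction of the quaternionic one
(`IsScalarTower ℝ ℍ[ℝ]ᵐᵒᵖ V`). Bounded right linear operators are `V →L[ℍ[ℝ]ᵐᵒᵖ] V`.
-/

section Operators

variable {V : Type*} [NormedAddCommGroup V] [NormedSpace ℝ V] [Module ℍ[ℝ]ᵐᵒᵖ V]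
  [IsScalarTower ℝ ℍ[ℝ]ᵐᵒᵖ V]

/-- The operator `R_q(A) = A² - 2 Re(q) A + |q|² I`. -/
noncomputable def pseudoResolvent (A : V →L[ℍ[ℝ]ᵐᵒᵖ] V) (q : ℍ[ℝ]) : V →L[ℍ[ℝ]ᵐᵒᵖ] V :=
  A ^ 2 - (2 * q.re) • A + (‖q‖ ^ 2) • (1 : V →L[ℍ[ℝ]ᵐᵒᵖ] V)

/-- The `S`-spectrum: the quaternions `q` for which `R_q(A)` has no bounded inverse. -/
def sSpectrum (A : V →L[ℍ[ℝ]ᵐᵒᵖ] V) : Set ℍ[ℝ] :=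
  {q | ¬ IsUnit (pseudoResolvent A q)}

/-- The restriction `A|Y` of `A` to an invariant right linear subspace `Y`. -/
noncomputable def restrictTo (A : V →L[ℍ[ℝ]ᵐᵒᵖ] V) (Y : Submodule ℍ[ℝ]ᵐᵒᵖ V) (hY : ∀ φ ∈ Y, A φ ∈ Y) :
    Y →L[ℍ[ℝ]ᵐᵒᵖ] Y :=
  A.restrict hY

/-- `A` is decomposable: every cover of the quaternions by two open sets `U₁`, `U₂` splits the
space as a (not necessarily direct) sum of two closed invariant right linear subspaces on which
the `S`-spectrum of `A` lies in `U₁` and in `U₂` respectively. -/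
def IsDecomposable (A : V →L[ℍ[ℝ]ᵐᵒᵖ] V) : Prop :=
  ∀ U₁ U₂ : Set ℍ[ℝ], IsOpen U₁ → IsOpen U₂ → U₁ ∪ U₂ = Set.univ →
    ∃ (Y Z : Submodule ℍ[ℝ]ᵐᵒᵖ V) (hY : ∀ φ ∈ Y, A φ ∈ Y) (hZ : ∀ φ ∈ Z, A φ ∈ Z),
      IsClosed (Y : Set V) ∧ IsClosed (Z : Set V) ∧
      sSpectrum (restrictTo A Y hY) ⊆ U₁ ∧ sSpectrum (restrictTo A Z hZ) ⊆ U₂ ∧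
      Y ⊔ Z = ⊤

end Operators

/-- The sphere of imaginary units. -/
def imaginaryUnits : Set ℍ[ℝ] := {I | I.re = 0 ∧ ‖I‖ = 1}

/-- The complex plane `ℂ_I = ℝ + I ℝ`. -/
def slicePlane (I : ℍ[ℝ]) : Set ℍ[ℝ] := {q | ∃ x y : ℝ, q = (x : ℍ[ℝ]) + (y : ℍ[ℝ]) * I}

section SliceRegular

variable {V : Type*} [NormedAddCommGroup V] [NormedSpace ℝ V] [Module ℍ[ℝ]ᵐᵒᵖ V]

/-- Right slice-regularity on an open set `U` of a function with values in `V`. At a point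
`q = x + y I` of `ℂ_I`, the partial derivatives of `f_I (x + y I)` in `x` and in `y` are the
derivatives of `f` at `q` along `1` and along `I`. Only the values of `f` on `U` matter. -/
structure IsRightSliceRegularOn (f : ℍ[ℝ] → V) (U : Set ℍ[ℝ]) : Prop where
  /-- `f` has partial derivatives in the four real coordinates. -/
  real_differentiable : ∀ q ∈ U,
    LineDifferentiableAt ℝ f q ⟨1, 0, 0, 0⟩ ∧ LineDifferentiableAt ℝ f q ⟨0, 1, 0, 0⟩ ∧
    LineDifferentiableAt ℝ f q ⟨0, 0, 1, 0⟩ ∧ LineDifferentiableAt ℝ f q ⟨0, 0, 0, 1⟩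
  /-- The restriction to each slice has partial derivatives in `x` and `y`. -/
  slice_differentiable : ∀ I ∈ imaginaryUnits, ∀ q ∈ U ∩ slicePlane I,
    LineDifferentiableAt ℝ f q 1 ∧ LineDifferentiableAt ℝ f q I
  /-- These partial derivatives are continuous on the slice. -/
  slice_continuous : ∀ I ∈ imaginaryUnits,
    ContinuousOn (fun q => lineDeriv ℝ f q 1) (U ∩ slicePlane I) ∧
    ContinuousOn (fun q => lineDeriv ℝ f q I) (U ∩ slicePlane I)
  /-- The right Cauchy-Riemann equation `(∂f_I/∂x + (∂f_I/∂y) I) / 2 = 0` on each slice. -/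
  cauchy_riemann : ∀ I ∈ imaginaryUnits, ∀ q ∈ U ∩ slicePlane I,
    (1 / 2 : ℝ) • (lineDeriv ℝ f q 1 + MulOpposite.op I • lineDeriv ℝ f q I) = 0

/-- Bishop's property (β). -/
def HasBishopProperty [IsScalarTower ℝ ℍ[ℝ]ᵐᵒᵖ V] (A : V →L[ℍ[ℝ]ᵐᵒᵖ] V) : Prop :=
  ∀ (U : Set ℍ[ℝ]), IsOpen U → ∀ f : ℕ → ℍ[ℝ] → V,
    (∀ n, ContinuousOn (f n) U ∧ IsRightSliceRegularOn (f n) U) →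
    (∀ K ⊆ U, IsCompact K →
      TendstoUniformlyOn (fun n q => pseudoResolvent A q (f n q)) 0 Filter.atTop K) →
    TendstoLocallyUniformlyOn f 0 Filter.atTop U

end SliceRegular

end QuaternionicOperator

/-! Fix `p` in `U` and a small radius `R`. Decomposability gives `V = Y + Z`, where `A|Y` has its
spectrum close to the sphere of `p` and `A|Z` has its spectrum away from it. Write `R_q(A) f(q) = y
+ z` with `‖y‖` controlled, `f(q) = g + h` with `g ∈ Y`, `h ∈ Z`, and `y = R_q(A) k` with `k ∈ Y`.
For `q` off the spectrum of `A|Y`, `R_q(A)` maps `g - k` into `Y ∩ Z`. The inverse of `R_q(A|Y)`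
preserves `Y ∩ Z`, because `q` can escape to infinity along a real ray off that spectrum
(`mem_of_pseudoResolvent_mem`). So `g - k ∈ Z`, and `f(q)` is within `‖k‖` of `Z`. On a slice `f` is
holomorphic, so the maximum principle in `V / Z` carries this bound from a circle around the sphere
of `p` to its interior. There `R_q(A|Z)` is invertible, so an element of `Z` near `f(q)` is itself
small. This gives the estimate `IsDecomposable.exists_norm_le`, with a constant independent of `f`.
-/

open Filter Topology

namespace QuaternionicOperator

/-! ### Inverses in closed subalgebras of a real Banach algebra -/

section BanachAlgebra

variable {𝒜 : Type*} [NormedRing 𝒜] [NormedAlgebra ℝ 𝒜]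

/-- The element `T² - 2 Re(q) T + |q|²` of a real algebra. -/
noncomputable def quadratic (T : 𝒜) (q : ℍ[ℝ]) : 𝒜 :=
  T ^ 2 - (2 * q.re) • T + (‖q‖ ^ 2) • (1 : 𝒜)

lemma continuous_quadratic (T : 𝒜) : Continuous (quadratic T) := by
  have := Quaternion.continuous_re
  unfold quadratic
  fun_prop

/-- Along a real ray the quadratic polynomial is eventually invertible. -/
lemma eventually_isUnit_quadratic_ray [CompleteSpace 𝒜] (T : 𝒜) (q : ℍ[ℝ]) {s : ℝ} (hs : s ≠ 0) :
    ∀ᶠ t : ℝ in atTop, IsUnit (quadratic T (q + ((s * t : ℝ) : ℍ[ℝ]))) := by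
  have hinv : Tendsto (fun t : ℝ => (‖q + ((s * t : ℝ) : ℍ[ℝ])‖)⁻¹) atTop (𝓝 0) := by
    refine tendsto_inv_atTop_zero.comp ?_
    have h1 : Tendsto (fun t : ℝ => |s| * t - ‖q‖) atTop atTop :=
      tendsto_atTop_add_const_right _ _ (tendsto_id.const_mul_atTop (abs_pos.2 hs))
    refine tendsto_atTop_mono' _ ?_ h1
    filter_upwards [eventually_ge_atTop 0] with t ht
    have h2 := norm_sub_le (q + ((s * t : ℝ) : ℍ[ℝ])) q
    rw [add_sub_cancel_left, Quaternion.norm_coe, Real.norm_eq_abs, abs_mul, abs_of_nonneg ht] at h2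
    linarith
  have hre : Tendsto (fun t : ℝ => (2 * (q + ((s * t : ℝ) : ℍ[ℝ])).re) *
      (‖q + ((s * t : ℝ) : ℍ[ℝ])‖⁻¹ ^ 2)) atTop (𝓝 0) := by
    refine squeeze_zero_norm (a := fun t : ℝ => 2 * ‖q + ((s * t : ℝ) : ℍ[ℝ])‖⁻¹) (fun t => ?_)
      (by simpa using hinv.const_mul 2)
    set p := q + ((s * t : ℝ) : ℍ[ℝ])
    have h3 : |p.re| ≤ ‖p‖ := by
      apply abs_le_of_sq_le_sq _ (norm_nonneg _)
      have := Quaternion.normSq_eq_norm_mul_self p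
      rw [Quaternion.normSq_def'] at this
      nlinarith [sq_nonneg p.imI, sq_nonneg p.imJ, sq_nonneg p.imK]
    rw [Real.norm_eq_abs, abs_mul, abs_mul, abs_two, abs_of_nonneg (sq_nonneg ‖p‖⁻¹), mul_assoc]
    refine mul_le_mul_of_nonneg_left ?_ zero_le_two
    calc |p.re| * ‖p‖⁻¹ ^ 2 ≤ ‖p‖ * ‖p‖⁻¹ ^ 2 := by gcongr
      _ = (‖p‖ * ‖p‖⁻¹) * ‖p‖⁻¹ := by ring
      _ ≤ 1 * ‖p‖⁻¹ := by gcongr; exact mul_inv_le_one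
      _ = ‖p‖⁻¹ := one_mul _
  -- Divided by `‖p‖²` at the moving point `p`, the polynomial tends to `1`, and the units form a
  -- neighbourhood of `1`.
  have hlim : Tendsto (fun t : ℝ => (‖q + ((s * t : ℝ) : ℍ[ℝ])‖⁻¹ ^ 2) • T ^ 2 -
      ((2 * (q + ((s * t : ℝ) : ℍ[ℝ])).re) * (‖q + ((s * t : ℝ) : ℍ[ℝ])‖⁻¹ ^ 2)) • T + 1)
      atTop (𝓝 1) := by
    have := (((hinv.pow 2).smul_const (T ^ 2)).sub (hre.smul_const T)).add_const 1
    simpa using this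
  have hopen := hlim.eventually (Units.nhds (1 : 𝒜ˣ))
  have hne : ∀ᶠ t : ℝ in atTop, ‖q + ((s * t : ℝ) : ℍ[ℝ])‖ ≠ 0 := by
    filter_upwards [eventually_gt_atTop (‖q‖ / |s|)] with t ht h0
    rw [norm_eq_zero, add_eq_zero_iff_eq_neg] at h0
    have h4 : ‖q‖ = |s| * |t| := by
      rw [h0, norm_neg, Quaternion.norm_coe, Real.norm_eq_abs, abs_mul]
    rw [div_lt_iff₀ (abs_pos.2 hs), h4] at ht
    nlinarith [le_abs_self t, abs_pos.2 hs]
  filter_upwards [hopen, hne] with t ht hn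
  set p := q + ((s * t : ℝ) : ℍ[ℝ])
  have hq : quadratic T p = (‖p‖ ^ 2) • ((‖p‖⁻¹ ^ 2) • T ^ 2 - ((2 * p.re) * (‖p‖⁻¹ ^ 2)) • T + 1) := by
    rw [quadratic, smul_add, smul_sub, smul_smul, smul_smul]
    congr 3
    · rw [← mul_pow, mul_inv_cancel₀ hn, one_pow, one_smul]
    · field_simp
  rw [hq]
  exact (isUnit_smul_iff (Units.mk0 _ (pow_ne_zero 2 hn)) _).2 ht

/-- Permanence of invertibility in a closed subalgebra: an element of the form `quadratic T q`
that can be moved to infinity along a real ray through invertible elements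
has its inverse in the subalgebra. -/
lemma isUnit_quadratic_subalgebra [CompleteSpace 𝒜] (S : Subalgebra ℝ 𝒜)
    (hS : IsClosed (S : Set 𝒜)) (T : S) (q : ℍ[ℝ]) {s : ℝ} (hs : s ≠ 0)
    (h : ∀ t : ℝ, 0 ≤ t → IsUnit (quadratic (T : 𝒜) (q + ((s * t : ℝ) : ℍ[ℝ])))) :
    IsUnit (quadratic T q) := by
  have : CompleteSpace S := hS.completeSpace_coe
  let a : ℝ → S := fun t => quadratic T (q + ((s * t : ℝ) : ℍ[ℝ]))
  have hcoe : Continuous fun x : ℝ => (x : ℍ[ℝ]) := Quaternion.continuous_coe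
  have ha : Continuous a := (continuous_quadratic T).comp (by fun_prop)
  have hopen : IsOpen {t | IsUnit (a t)} := Units.isOpen.preimage ha
  have hsub : Set.Ici (0 : ℝ) ⊆ {t | IsUnit (a t)} := by
    -- Connectedness of the ray: the good parameters form an open set, contain all large `t`, and
    -- are relatively closed.
    refine isPreconnected_Ici.subset_of_closure_inter_subset hopen ?_ ?_
    · obtain ⟨t, ht, ht0⟩ :=
        ((eventually_isUnit_quadratic_ray T q hs).and (eventually_ge_atTop 0)).exists
      exact ⟨t, ht0, ht⟩
    · rintro t ⟨htc, ht0⟩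
      have hl := mem_closure_iff_nhdsWithin_neBot.1 htc
      -- The limit is invertible in `𝒜`, so the inverses converge there, and `S` is closed.
      refine Subalgebra.isUnit_of_isUnit_val_of_eventually (S := S) (l := map a (𝓝[{t | IsUnit (a t)}] t))
        (h t ht0) ?_ ?_ (hl.map a)
      · exact (map_mono nhdsWithin_le_nhds).trans ha.continuousAt
      · exact eventually_map.2 (eventually_mem_nhdsWithin)
  simpa [a] using hsub (Set.self_mem_Ici (a := (0 : ℝ)))

lemma exists_bound_inverse_quadratic [CompleteSpace 𝒜] (T : 𝒜) {K : Set ℍ[ℝ]} (hK : IsCompact K)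
    (h : ∀ q ∈ K, IsUnit (quadratic T q)) :
    ∃ M, 0 ≤ M ∧ ∀ q ∈ K, ‖Ring.inverse (quadratic T q)‖ ≤ M := by
  have hc : ContinuousOn (fun q => Ring.inverse (quadratic T q)) K := fun q hq => by
    obtain ⟨u, hu⟩ := h q hq
    refine ContinuousAt.continuousWithinAt ?_
    refine ContinuousAt.comp (g := Ring.inverse) ?_ (continuous_quadratic T).continuousAt
    rw [← hu]
    exact NormedRing.inverse_continuousAt u
  obtain ⟨M, hM⟩ := hK.exists_bound_of_continuousOn hc
  exact ⟨max M 0, le_max_right _ _, fun q hq => (hM q hq).trans (le_max_left _ _)⟩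

/-- If `q` can be moved to infinity along a real ray through points where the quadratic polynomial
in `T` is invertible, then its inverse at `q` leaves every closed `T`-invariant subspace
invariant. -/
lemma mem_of_quadratic_apply_mem {E : Type*} [NormedAddCommGroup E] [NormedSpace ℝ E]
    [CompleteSpace E] {T : E →L[ℝ] E} {W : Submodule ℝ E} (hWc : IsClosed (W : Set E))
    (hW : ∀ w ∈ W, T w ∈ W) {q : ℍ[ℝ]} {s : ℝ} (hs : s ≠ 0)
    (h : ∀ t : ℝ, 0 ≤ t → IsUnit (quadratic T (q + ((s * t : ℝ) : ℍ[ℝ]))))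
    {w : E} (hw : quadratic T q w ∈ W) : w ∈ W := by
  -- The closed subalgebra of operators that preserve `W`.
  let S : Subalgebra ℝ (E →L[ℝ] E) :=
    { carrier := {B | ∀ w ∈ W, B w ∈ W}
      mul_mem' := fun {B C} hB hC w hw => hB _ (hC w hw)
      add_mem' := fun {B C} hB hC w hw => W.add_mem (hB w hw) (hC w hw)
      algebraMap_mem' := fun r w hw => W.smul_mem r hw }
  have hS : IsClosed (S : Set (E →L[ℝ] E)) := by
    have : (S : Set (E →L[ℝ] E)) = ⋂ w ∈ W, {B | B w ∈ W} := by
      ext B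
      simp only [Set.mem_iInter]
      rfl
    rw [this]
    exact isClosed_biInter fun w _ =>
      hWc.preimage (ContinuousLinearMap.apply ℝ E w).continuous
  obtain ⟨u, hu⟩ := isUnit_quadratic_subalgebra S hS ⟨T, hW⟩ q hs h
  have h1 : ((↑u⁻¹ : S) : E →L[ℝ] E) * quadratic T q = 1 := by
    rw [← S.coe_one, ← u.inv_mul, hu]
    rfl
  have h2 := (↑u⁻¹ : S).2 _ hw
  rwa [← mul_apply_eq_comp, h1, one_apply_eq_self] at h2

end BanachAlgebra

/-! ### Passage from quaternionic to real operators -/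

section Operators

variable {V : Type*} [NormedAddCommGroup V] [NormedSpace ℝ V] [Module ℍ[ℝ]ᵐᵒᵖ V]
  [IsScalarTower ℝ ℍ[ℝ]ᵐᵒᵖ V]

lemma quadratic_restrictScalars_apply (A : V →L[ℍ[ℝ]ᵐᵒᵖ] V) (q : ℍ[ℝ]) (v : V) :
    quadratic (A.restrictScalars ℝ) q v = pseudoResolvent A q v := by
  simp [quadratic, pseudoResolvent, pow_two]

lemma isUnit_quadratic_of_notMem_sSpectrum {A : V →L[ℍ[ℝ]ᵐᵒᵖ] V} {q : ℍ[ℝ]}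
    (h : q ∉ sSpectrum A) : IsUnit (quadratic (A.restrictScalars ℝ) q) := by
  obtain ⟨u, hu⟩ := not_not.1 h
  refine ⟨⟨quadratic (A.restrictScalars ℝ) q,
    (↑u⁻¹ : V →L[ℍ[ℝ]ᵐᵒᵖ] V).restrictScalars ℝ, ?_, ?_⟩, rfl⟩
  · ext v
    rw [mul_apply_eq_comp, quadratic_restrictScalars_apply, ← hu]
    exact congrArg (fun B : V →L[ℍ[ℝ]ᵐᵒᵖ] V => B v) u.mul_inv
  · ext v
    rw [mul_apply_eq_comp, quadratic_restrictScalars_apply, ← hu]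
    exact congrArg (fun B : V →L[ℍ[ℝ]ᵐᵒᵖ] V => B v) u.inv_mul

lemma coe_pseudoResolvent_restrictTo (A : V →L[ℍ[ℝ]ᵐᵒᵖ] V) (Y : Submodule ℍ[ℝ]ᵐᵒᵖ V)
    (hY : ∀ φ ∈ Y, A φ ∈ Y) (q : ℍ[ℝ]) (y : Y) :
    (pseudoResolvent (restrictTo A Y hY) q y : V) = pseudoResolvent A q y := by
  simp [pseudoResolvent, pow_two, restrictTo]

lemma pseudoResolvent_mem {A : V →L[ℍ[ℝ]ᵐᵒᵖ] V} {Z : Submodule ℍ[ℝ]ᵐᵒᵖ V}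
    (hZ : ∀ φ ∈ Z, A φ ∈ Z) (q : ℍ[ℝ]) {v : V} (hv : v ∈ Z) : pseudoResolvent A q v ∈ Z := by
  have h := (pseudoResolvent (restrictTo A Z hZ) q ⟨v, hv⟩).2
  rwa [coe_pseudoResolvent_restrictTo] at h

end Operators

end QuaternionicOperator

namespace QuaternionicOperator

/-! ### Maximum principle modulo a subspace; Cauchy-Riemann equations -/

section ComplexAnalysis

/-- The maximum principle for the distance of a holomorphic function to a closed subspace. -/
lemma infDist_le_of_forall_mem_sphere {E : Type*} [NormedAddCommGroup E] [NormedSpace ℂ E]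
    (p : Submodule ℂ E) (hp : IsClosed (p : Set E)) {F : ℂ → E} {c : ℂ} {r C : ℝ} (hr : r ≠ 0)
    (hF : DiffContOnCl ℂ F (Metric.ball c r))
    (hC : ∀ z ∈ Metric.sphere c r, Metric.infDist (F z) p ≤ C) {z : ℂ}
    (hz : z ∈ Metric.closedBall c r) : Metric.infDist (F z) p ≤ C := by
  have : IsClosed (p : Set E) := hp
  -- The distance to `p` is the quotient norm, so the usual maximum principle applies in `E ⧸ p`.
  have hnorm : ∀ v : E, ‖p.mkQL v‖ = Metric.infDist v p := fun v =>
    QuotientAddGroup.norm_mk (S := p.toAddSubgroup) v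
  have hd : DiffContOnCl ℂ (fun z => p.mkQL (F z)) (Metric.ball c r) :=
    ⟨p.mkQL.differentiable.comp_differentiableOn hF.1, p.mkQL.continuous.comp_continuousOn hF.2⟩
  rw [← hnorm]
  refine Complex.norm_le_of_forall_mem_frontier_norm_le Metric.isBounded_ball hd (fun w hw => ?_)
    (by rwa [closure_ball c hr])
  rw [hnorm]
  exact hC w (by rwa [frontier_ball c hr] at hw)

/-- A function with continuous partial derivatives satisfying the Cauchy-Riemann equation is
complex differentiable. -/
lemma differentiableAt_of_partial_cauchyRiemann {E : Type*} [NormedAddCommGroup E] [NormedSpace ℂ E]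
    [NormedSpace ℝ E] [IsScalarTower ℝ ℂ E] {F Fx Fy : ℂ → E} {s : Set ℂ} (hs : IsOpen s)
    (hx : ∀ z ∈ s, HasDerivAt (fun t : ℝ => F (z + t)) (Fx z) 0)
    (hy : ∀ z ∈ s, HasDerivAt (fun t : ℝ => F (z + t * Complex.I)) (Fy z) 0)
    (hcx : ContinuousOn Fx s) (hcy : ContinuousOn Fy s)
    (hcr : ∀ z ∈ s, Fx z + Complex.I • Fy z = 0) {z : ℂ} (hz : z ∈ s) :
    DifferentiableAt ℂ F z := by
  let e := Complex.equivRealProdCLM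
  have hes : ∀ x y : ℝ, e.symm (x, y) = x + y * Complex.I := fun x y => by
    simp [e, Complex.equivRealProdCLM_symm_apply]
  let G : ℝ → ℝ → E := fun x y => F (e.symm (x, y))
  let sm : E →L[ℝ] (ℝ →L[ℝ] E) := ContinuousLinearMap.smulRightL ℝ ℝ E 1
  have hsm : ∀ v : E, sm v = ContinuousLinearMap.smulRight (1 : ℝ →L[ℝ] ℝ) v := fun v => rfl
  have hev : ∀ᶠ v in 𝓝 (e z), e.symm v ∈ s :=
    e.symm.continuous.continuousAt.eventually (by simpa using hs.mem_nhds hz)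
  have hcont : ∀ H : ℂ → E, ContinuousOn H s →
      ContinuousAt (fun v : ℝ × ℝ => sm (H (e.symm v))) (e z) := fun H hH => by
    refine sm.continuous.continuousAt.comp ?_
    refine ContinuousAt.comp (f := e.symm) (g := H) ?_ e.symm.continuous.continuousAt
    simpa using hH.continuousAt (hs.mem_nhds hz)
  have key := hasStrictFDerivAt_uncurry_coprod (𝕜 := ℝ) (u := e z) (f := G)
    (f₁ := fun x y => sm (Fx (e.symm (x, y)))) (f₂ := fun x y => sm (Fy (e.symm (x, y))))
    (by
      filter_upwards [hev] with v hv
      have h := hx _ hv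
      have h2 : HasDerivAt (fun t : ℝ => F (e.symm v + t)) (Fx (e.symm v)) (v.1 - v.1) := by
        simpa using h
      have h3 := h2.comp_sub_const v.1 v.1
      refine HasDerivAt.hasFDerivAt ?_
      convert h3 using 2 with t
      change F (e.symm (t, v.2)) = F (e.symm (v.1, v.2) + (t - v.1 : ℝ))
      rw [hes, hes]
      congr 1
      push_cast
      ring)
    (by
      filter_upwards [hev] with v hv
      have h := hy _ hv
      have h2 : HasDerivAt (fun t : ℝ => F (e.symm v + t * Complex.I)) (Fy (e.symm v))
          (v.2 - v.2) := by
        simpa using h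
      have h3 := h2.comp_sub_const v.2 v.2
      refine HasDerivAt.hasFDerivAt ?_
      convert h3 using 2 with t
      change F (e.symm (v.1, t)) = F (e.symm (v.1, v.2) + (t - v.2 : ℝ) * Complex.I)
      rw [hes, hes]
      congr 1
      push_cast
      ring)
    (hcont Fx hcx) (hcont Fy hcy)
  have key2 := key.hasFDerivAt.comp z e.hasFDerivAt
  have hFeq : (↿G ∘ e) = F := by
    ext w
    change F (e.symm (e w)) = F w
    rw [e.symm_apply_apply]
  rw [hFeq] at key2
  -- The Cauchy-Riemann equation turns the real derivative into multiplication by `Fx z`, which is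
  -- complex linear.
  have hFy : Fx z = -(Complex.I • Fy z) := eq_neg_of_add_eq_zero_left (hcr z hz)
  have hIy : Complex.I • Fx z = Fy z := by
    rw [hFy, smul_neg, smul_smul, Complex.I_mul_I, neg_smul, one_smul, neg_neg]
  refine (hasFDerivAt_of_restrictScalars ℝ key2
    (f' := ContinuousLinearMap.smulRight (1 : ℂ →L[ℂ] ℂ) (Fx z)) ?_).differentiableAt
  ext w
  have hz' : e.symm ((e z).1, (e z).2) = z := e.symm_apply_apply z
  change w • Fx z = w.re • Fx (e.symm ((e z).1, (e z).2)) + w.im • Fy (e.symm ((e z).1, (e z).2))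
  rw [hz', ← hIy, ← algebraMap_smul ℂ w.re (Fx z), ← algebraMap_smul ℂ w.im (Complex.I • Fx z),
    smul_smul, ← add_smul]
  congr 1
  exact (Complex.re_add_im w).symm

end ComplexAnalysis

/-! ### Slices and slice-regular functions -/

section Slices

variable {V : Type*} [NormedAddCommGroup V] [NormedSpace ℝ V] [Module ℍ[ℝ]ᵐᵒᵖ V]

/-- The parametrization `x + y i ↦ x + y I` of the slice `ℂ_I`. -/
noncomputable def slicePoint (I : ℍ[ℝ]) (z : ℂ) : ℍ[ℝ] := (z.re : ℍ[ℝ]) + (z.im : ℍ[ℝ]) * I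

lemma slicePoint_mem_slicePlane (I : ℍ[ℝ]) (z : ℂ) : slicePoint I z ∈ slicePlane I :=
  ⟨z.re, z.im, rfl⟩

lemma slicePoint_eq_smul (I : ℍ[ℝ]) (z : ℂ) :
    slicePoint I z = z.re • (1 : ℍ[ℝ]) + z.im • I := by
  rw [slicePoint, Quaternion.coe_mul_eq_smul, ← mul_one (z.re : ℍ[ℝ]), Quaternion.coe_mul_eq_smul]

lemma slicePoint_sub (I : ℍ[ℝ]) (z w : ℂ) :
    slicePoint I (z - w) = slicePoint I z - slicePoint I w := by
  simp only [slicePoint_eq_smul, Complex.sub_re, Complex.sub_im, sub_smul]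
  abel

lemma continuous_slicePoint (I : ℍ[ℝ]) : Continuous (slicePoint I) := by
  simp only [funext (slicePoint_eq_smul I)]
  fun_prop

lemma re_slicePoint {I : ℍ[ℝ]} (hI : I ∈ imaginaryUnits) (z : ℂ) : (slicePoint I z).re = z.re := by
  simp [slicePoint_eq_smul, hI.1]

lemma norm_im_slicePoint {I : ℍ[ℝ]} (hI : I ∈ imaginaryUnits) (z : ℂ) :
    ‖(slicePoint I z).im‖ = |z.im| := by
  have h : (slicePoint I z).im = z.im • I := by
    ext <;> simp [slicePoint_eq_smul, hI.1]
  rw [h, norm_smul, hI.2, mul_one, Real.norm_eq_abs]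

lemma norm_sq_eq_re_sq_add_norm_im_sq (q : ℍ[ℝ]) : ‖q‖ ^ 2 = q.re ^ 2 + ‖q.im‖ ^ 2 := by
  have h1 := Quaternion.normSq_eq_norm_mul_self q
  have h2 := Quaternion.normSq_eq_norm_mul_self q.im
  rw [Quaternion.normSq_def'] at h1 h2
  simp at h2
  nlinarith

lemma norm_slicePoint {I : ℍ[ℝ]} (hI : I ∈ imaginaryUnits) (z : ℂ) : ‖slicePoint I z‖ = ‖z‖ := by
  rw [← sq_eq_sq₀ (norm_nonneg _) (norm_nonneg _), norm_sq_eq_re_sq_add_norm_im_sq,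
    re_slicePoint hI, norm_im_slicePoint hI, sq_abs, Complex.sq_norm, Complex.normSq_apply]
  ring

lemma mul_self_of_mem_imaginaryUnits {I : ℍ[ℝ]} (hI : I ∈ imaginaryUnits) : I * I = -1 := by
  have h1 := Quaternion.normSq_eq_norm_mul_self I
  rw [Quaternion.normSq_def', hI.1, hI.2] at h1
  ext <;> simp [hI.1] <;> nlinarith

/-- Every quaternion lies on the closed upper half of some slice. -/
lemma exists_slicePoint_eq (q : ℍ[ℝ]) :
    ∃ I ∈ imaginaryUnits, slicePoint I ⟨q.re, ‖q.im‖⟩ = q := by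
  by_cases h : q.im = 0
  · obtain ⟨i, h0, h1, h2, h3⟩ :
        ∃ i : ℍ[ℝ], i.re = 0 ∧ i.imI = 1 ∧ i.imJ = 0 ∧ i.imK = 0 :=
      ⟨⟨0, 1, 0, 0⟩, rfl, rfl, rfl, rfl⟩
    refine ⟨i, ⟨h0, ?_⟩, ?_⟩
    · have hi := Quaternion.normSq_eq_norm_mul_self i
      rw [Quaternion.normSq_def', h0, h1, h2, h3] at hi
      nlinarith [norm_nonneg i]
    · have := Quaternion.re_add_im q
      rw [h, add_zero] at this
      rw [slicePoint, h, norm_zero, Quaternion.coe_zero, zero_mul, add_zero, this]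
  · have hn : ‖q.im‖ ≠ 0 := norm_ne_zero_iff.2 h
    refine ⟨‖q.im‖⁻¹ • q.im, ⟨by simp, ?_⟩, ?_⟩
    · rw [norm_smul, norm_inv, norm_norm, inv_mul_cancel₀ hn]
    · rw [slicePoint, Quaternion.coe_mul_eq_smul, smul_smul, mul_inv_cancel₀ hn, one_smul]
      exact Quaternion.re_add_im q

/-- The maximum principle for the distance of a slice-regular function to a closed right linear
subspace, on a disc of a slice. -/
lemma IsRightSliceRegularOn.infDist_le_of_forall_mem_sphere [IsScalarTower ℝ ℍ[ℝ]ᵐᵒᵖ V]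
    [NormSMulClass ℍ[ℝ]ᵐᵒᵖ V] {f : ℍ[ℝ] → V} {U : Set ℍ[ℝ]} (hU : IsOpen U)
    (hf : IsRightSliceRegularOn f U) (Z : Submodule ℍ[ℝ]ᵐᵒᵖ V) (hZ : IsClosed (Z : Set V))
    {I : ℍ[ℝ]} (hI : I ∈ imaginaryUnits) {c : ℂ} {r C : ℝ} (hr : r ≠ 0)
    (hsub : ∀ z ∈ Metric.closedBall c r, slicePoint I z ∈ U)
    (hC : ∀ z ∈ Metric.sphere c r, Metric.infDist (f (slicePoint I z)) Z ≤ C) {z : ℂ}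
    (hz : z ∈ Metric.closedBall c r) : Metric.infDist (f (slicePoint I z)) Z ≤ C := by
  have hII : MulOpposite.op I * MulOpposite.op I = -1 := by
    rw [← MulOpposite.op_mul, mul_self_of_mem_imaginaryUnits hI]; rfl
  -- Since `I² = -1`, right multiplication by `x + y I` makes `V` a complex normed space, in which
  -- `Z` is a complex subspace.
  let φ : ℂ →ₐ[ℝ] ℍ[ℝ]ᵐᵒᵖ := Complex.liftAux (MulOpposite.op I) hII
  have hφ : ∀ w : ℂ, φ w = MulOpposite.op (slicePoint I w) := fun w => by
    rw [slicePoint_eq_smul, MulOpposite.op_add, MulOpposite.op_smul, MulOpposite.op_smul,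
      MulOpposite.op_one, Complex.liftAux_apply, Algebra.algebraMap_eq_smul_one]
  let : Module ℂ V := Module.compHom V φ.toRingHom
  have hsmul : ∀ (w : ℂ) (v : V), w • v = φ w • v := fun _ _ => rfl
  let : NormedSpace ℂ V := ⟨fun w v => by
    rw [hsmul, norm_smul, hφ, MulOpposite.norm_op, norm_slicePoint hI]⟩
  let p : Submodule ℂ V :=
    { carrier := Z
      add_mem' := Z.add_mem
      zero_mem' := Z.zero_mem
      smul_mem' := fun w v hv => Z.smul_mem (φ w) hv }
  refine QuaternionicOperator.infDist_le_of_forall_mem_sphere p hZ (F := fun w => f (slicePoint I w))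
    hr ?_ hC hz
  have : IsScalarTower ℝ ℂ V := ⟨fun a w v => by
    rw [hsmul, hsmul, map_smul, smul_assoc]⟩
  have hline : ∀ (z : ℂ) (t : ℝ), slicePoint I (z + t) = slicePoint I z + t • (1 : ℍ[ℝ]) ∧
      slicePoint I (z + t * Complex.I) = slicePoint I z + t • I := fun z t => by
    constructor <;> simp [slicePoint_eq_smul, add_smul, add_assoc, add_comm, add_left_comm]
  have hmap : Set.MapsTo (slicePoint I) (slicePoint I ⁻¹' U) (U ∩ slicePlane I) := fun w hw =>
    ⟨hw, slicePoint_mem_slicePlane I w⟩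
  have hdiff : ∀ w ∈ slicePoint I ⁻¹' U, DifferentiableAt ℂ (fun w => f (slicePoint I w)) w := by
    intro w hw
    refine differentiableAt_of_partial_cauchyRiemann
      (Fx := fun w => lineDeriv ℝ f (slicePoint I w) 1)
      (Fy := fun w => lineDeriv ℝ f (slicePoint I w) I) (hU.preimage (continuous_slicePoint I))
      (fun u hu => ?_) (fun u hu => ?_)
      ((hf.slice_continuous I hI).1.comp (continuous_slicePoint I).continuousOn hmap)
      ((hf.slice_continuous I hI).2.comp (continuous_slicePoint I).continuousOn hmap)
      (fun u hu => ?_) hw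
    · simp only [hline]
      exact (hf.slice_differentiable I hI _ (hmap hu)).1.hasLineDerivAt
    · simp only [hline]
      exact (hf.slice_differentiable I hI _ (hmap hu)).2.hasLineDerivAt
    · have h := hf.cauchy_riemann I hI _ (hmap hu)
      rw [smul_eq_zero_iff_right (by norm_num)] at h
      rw [hsmul, Complex.liftAux_apply_I]
      exact h
  exact ⟨fun w hw => (hdiff w (hsub w (Metric.ball_subset_closedBall hw))).differentiableWithinAt,
    fun w hw => (hdiff w (hsub w (Metric.closure_ball_subset_closedBall hw))).continuousAt
      |>.continuousWithinAt⟩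

end Slices

end QuaternionicOperator

namespace QuaternionicOperator

/-! ### Distance between axially symmetric spheres -/

section SliceDistance

/-- The squared distance of the axially symmetric spheres through two quaternions, measured in the
closed upper half-plane. -/
noncomputable def sphereDistSq (p q : ℍ[ℝ]) : ℝ := (q.re - p.re) ^ 2 + (‖q.im‖ - ‖p.im‖) ^ 2

lemma continuous_sphereDistSq (p : ℍ[ℝ]) : Continuous (sphereDistSq p) := by
  have := Quaternion.continuous_re
  have := Quaternion.continuous_im
  unfold sphereDistSq
  fun_prop

lemma sphereDistSq_le (p q : ℍ[ℝ]) : sphereDistSq p q ≤ ‖q - p‖ ^ 2 := by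
  rw [norm_sq_eq_re_sq_add_norm_im_sq, sphereDistSq, Quaternion.re_sub, Quaternion.im_sub]
  exact add_le_add_right (sq_le_sq.2 ((abs_norm_sub_norm_le q.im p.im).trans (le_abs_self _))) _

/-- From each point there is a real ray to infinity along which the distance does not decrease. -/
lemma exists_ray_sphereDistSq_le (p q : ℍ[ℝ]) :
    ∃ s : ℝ, s ≠ 0 ∧ ∀ t : ℝ, 0 ≤ t →
      sphereDistSq p q ≤ sphereDistSq p (q + ((s * t : ℝ) : ℍ[ℝ])) := by
  have hre : ∀ x : ℝ, (q + (x : ℍ[ℝ])).re = q.re + x := fun x => by simp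
  have him : ∀ x : ℝ, (q + (x : ℍ[ℝ])).im = q.im := fun x => by simp
  -- The ray moves the real part away from `p.re` and fixes the imaginary part.
  rcases le_total p.re q.re with h | h
  · refine ⟨1, one_ne_zero, fun t ht => ?_⟩
    rw [sphereDistSq, sphereDistSq, hre, him]
    nlinarith
  · refine ⟨-1, by norm_num, fun t ht => ?_⟩
    rw [sphereDistSq, sphereDistSq, hre, him]
    nlinarith

/-- Replacing `z.im` by `|z.im|` is harmless in the upper half-plane, or when the centre is real. -/
lemma sphereDistSq_slicePoint {I : ℍ[ℝ]} (hI : I ∈ imaginaryUnits) (p : ℍ[ℝ]) {z : ℂ}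
    (hz : ‖p.im‖ = 0 ∨ 0 ≤ z.im) :
    sphereDistSq p (slicePoint I z) = ‖z - ⟨p.re, ‖p.im‖⟩‖ ^ 2 := by
  rw [sphereDistSq, re_slicePoint hI, norm_im_slicePoint hI, Complex.sq_norm, Complex.normSq_apply]
  rcases hz with h | h
  · rw [Complex.sub_re, Complex.sub_im, h, sub_zero, sub_zero, sq_abs]
    ring
  · rw [Complex.sub_re, Complex.sub_im, abs_of_nonneg h]
    ring

end SliceDistance

/-! ### Estimates from the decomposition -/

section Decomposition

variable {V : Type*} [NormedAddCommGroup V] [NormedSpace ℝ V] [CompleteSpace V]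
  [Module ℍ[ℝ]ᵐᵒᵖ V] [IsScalarTower ℝ ℍ[ℝ]ᵐᵒᵖ V]

/-- If `q` can be moved to infinity along a real ray outside the `S`-spectrum of `A|Y`, the inverse
of `R_q(A|Y)` leaves `Y ∩ Z` invariant. -/
lemma mem_of_pseudoResolvent_mem {A : V →L[ℍ[ℝ]ᵐᵒᵖ] V} {Y Z : Submodule ℍ[ℝ]ᵐᵒᵖ V}
    (hYc : IsClosed (Y : Set V)) (hZc : IsClosed (Z : Set V))
    (hY : ∀ φ ∈ Y, A φ ∈ Y) (hZ : ∀ φ ∈ Z, A φ ∈ Z) {q : ℍ[ℝ]} {s : ℝ} (hs : s ≠ 0)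
    (hray : ∀ t : ℝ, 0 ≤ t → q + ((s * t : ℝ) : ℍ[ℝ]) ∉ sSpectrum (restrictTo A Y hY))
    {y : V} (hyY : y ∈ Y) (hy : pseudoResolvent A q y ∈ Z) : y ∈ Z := by
  have : CompleteSpace Y := hYc.completeSpace_coe
  refine mem_of_quadratic_apply_mem (E := Y) (T := (restrictTo A Y hY).restrictScalars ℝ)
    -- This is `Y ∩ Z`, seen as a real subspace of `Y`.
    (W := (Z.restrictScalars ℝ).comap ((Y.subtype).restrictScalars ℝ))
    (hZc.preimage continuous_subtype_val) (fun w hw => hZ _ hw) hs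
    (fun t ht => isUnit_quadratic_of_notMem_sSpectrum (hray t ht)) (w := ⟨y, hyY⟩) ?_
  rw [quadratic_restrictScalars_apply]
  change (pseudoResolvent (restrictTo A Y hY) q ⟨y, hyY⟩ : V) ∈ Z
  rwa [coe_pseudoResolvent_restrictTo]

/-- A bounded-below estimate for `R_q(A)` on an invariant subspace, uniform on compact sets off the
`S`-spectrum. -/
lemma exists_bound_of_disjoint_sSpectrum {A : V →L[ℍ[ℝ]ᵐᵒᵖ] V} {Y : Submodule ℍ[ℝ]ᵐᵒᵖ V}
    (hYc : IsClosed (Y : Set V)) (hY : ∀ φ ∈ Y, A φ ∈ Y) {K : Set ℍ[ℝ]} (hK : IsCompact K)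
    (h : ∀ q ∈ K, q ∉ sSpectrum (restrictTo A Y hY)) :
    ∃ M, 0 ≤ M ∧ ∀ q ∈ K, ∀ w ∈ Y, ∃ y ∈ Y, pseudoResolvent A q y = w ∧ ‖y‖ ≤ M * ‖w‖ ∧
      ∀ y' ∈ Y, pseudoResolvent A q y' = w → y' = y := by
  have : CompleteSpace Y := hYc.completeSpace_coe
  obtain ⟨M, hM0, hM⟩ := exists_bound_inverse_quadratic
    ((restrictTo A Y hY).restrictScalars ℝ) hK fun q hq =>
      isUnit_quadratic_of_notMem_sSpectrum (h q hq)
  refine ⟨M, hM0, fun q hq w hw => ?_⟩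
  set Q := quadratic ((restrictTo A Y hY).restrictScalars ℝ) q with hQ
  have hu : IsUnit Q := isUnit_quadratic_of_notMem_sSpectrum (h q hq)
  have hQv : ∀ v : Y, (Q v : V) = pseudoResolvent A q v := fun v => by
    rw [hQ, quadratic_restrictScalars_apply, coe_pseudoResolvent_restrictTo]
  refine ⟨(Ring.inverse Q ⟨w, hw⟩ : Y), SetLike.coe_mem _, ?_, ?_, fun y' hy' he => ?_⟩
  · rw [← hQv]
    exact congrArg (fun B : Y →L[ℝ] Y => (B ⟨w, hw⟩ : V)) (Ring.mul_inverse_cancel Q hu)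
  · exact (Ring.inverse Q).le_of_opNorm_le (hM q hq) ⟨w, hw⟩
  · have h1 : Q ⟨y', hy'⟩ = ⟨w, hw⟩ := Subtype.ext ((hQv _).trans he)
    rw [← h1]
    exact congrArg (fun B : Y →L[ℝ] Y => (B ⟨y', hy'⟩ : V)) (Ring.inverse_mul_cancel Q hu).symm

/-- The open mapping theorem for addition `Y × Z → V`. -/
lemma exists_add_decomposition_bound {Y Z : Submodule ℍ[ℝ]ᵐᵒᵖ V}
    (hYc : IsClosed (Y : Set V)) (hZc : IsClosed (Z : Set V)) (h : Y ⊔ Z = ⊤) :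
    ∃ C, 0 ≤ C ∧ ∀ v : V, ∃ y ∈ Y, ∃ z ∈ Z, y + z = v ∧ ‖y‖ ≤ C * ‖v‖ := by
  have : CompleteSpace Y := hYc.completeSpace_coe
  have : CompleteSpace Z := hZc.completeSpace_coe
  let L : Y × Z →L[ℝ] V :=
    (Y.subtypeL.restrictScalars ℝ).coprod (Z.subtypeL.restrictScalars ℝ)
  have hL : ∀ x : Y × Z, L x = (x.1 : V) + x.2 := fun x => rfl
  have hsurj : Function.Surjective L := fun v => by
    obtain ⟨y, hy, z, hz, rfl⟩ := Submodule.mem_sup.1 (h ▸ Submodule.mem_top : v ∈ Y ⊔ Z)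
    exact ⟨(⟨y, hy⟩, ⟨z, hz⟩), rfl⟩
  obtain ⟨C, hC, hCv⟩ := L.exists_preimage_norm_le hsurj
  refine ⟨C, hC.le, fun v => ?_⟩
  obtain ⟨x, hx, hn⟩ := hCv v
  exact ⟨x.1, x.1.2, x.2, x.2.2, (hL x).symm.trans hx, (norm_fst_le x).trans hn⟩

variable [NormSMulClass ℍ[ℝ]ᵐᵒᵖ V]

/-- The quantitative form of Bishop's property near a point. -/
lemma IsDecomposable.exists_norm_le {A : V →L[ℍ[ℝ]ᵐᵒᵖ] V} (hA : IsDecomposable A) (p : ℍ[ℝ])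
    {R : ℝ} (hR : 0 < R) (hp : ‖p.im‖ = 0 ∨ R ≤ ‖p.im‖) :
    ∃ B, 0 ≤ B ∧ ∀ U : Set ℍ[ℝ], IsOpen U → Metric.closedBall p R ⊆ U →
      ∀ f : ℍ[ℝ] → V, IsRightSliceRegularOn f U → ∀ η : ℝ, 0 < η →
        (∀ q ∈ Metric.closedBall p R, ‖pseudoResolvent A q (f q)‖ ≤ η) →
        ∀ q ∈ Metric.closedBall p (R / 6), ‖f q‖ ≤ B * η := by
  have hδ := continuous_sphereDistSq p
  -- `R / 6 < R / 5` makes the two sets overlap and cover; the circle of radius `R / 2` used below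
  -- lies outside the first, and the target ball of radius `R / 6` outside the second.
  obtain ⟨Y, Z, hY, hZ, hYc, hZc, hYσ, hZσ, hYZ⟩ := hA
    {q | sphereDistSq p q < (R / 5) ^ 2} {q | (R / 6) ^ 2 < sphereDistSq p q}
    (isOpen_lt hδ continuous_const) (isOpen_lt continuous_const hδ)
    (Set.eq_univ_of_forall fun q => by
      rcases lt_or_ge (sphereDistSq p q) ((R / 5) ^ 2) with h | h
      · exact Or.inl h
      · exact Or.inr (lt_of_lt_of_le (by gcongr; norm_num) h))
  have hball : IsCompact (Metric.closedBall p R) := isCompact_closedBall p R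
  obtain ⟨M, hM0, hM⟩ := exists_bound_of_disjoint_sSpectrum hYc hY
    (hball.inter_right (isClosed_le continuous_const hδ : IsClosed {q | (R / 5) ^ 2 ≤ sphereDistSq p q}))
    (fun q hq hσ => not_lt.2 hq.2.out (hYσ hσ).out)
  obtain ⟨M', hM0', hM'⟩ := exists_bound_of_disjoint_sSpectrum hZc hZ
    (hball.inter_right (isClosed_le hδ continuous_const : IsClosed {q | sphereDistSq p q ≤ (R / 6) ^ 2}))
    (fun q hq hσ => not_lt.2 hq.2.out (hZσ hσ).out)
  obtain ⟨C, hC0, hC⟩ := exists_add_decomposition_bound hYc hZc hYZ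
  obtain ⟨N, hN⟩ := hball.exists_bound_of_continuousOn
    (continuous_quadratic (A.restrictScalars ℝ)).continuousOn
  have hN0 : 0 ≤ N := (norm_nonneg _).trans (hN p (Metric.mem_closedBall_self hR.le))
  -- Here `M * C + 1` bounds the distance from `f q` to a nearby `h ∈ Z`, and the remaining term
  -- bounds `‖h‖`, both in units of `η`.
  refine ⟨M * C + 1 + M' * (1 + N * (M * C + 1)), by positivity,
    fun U hU hUR f hf η hη hfη q hq => ?_⟩
  have hdist : ∀ q ∈ Metric.closedBall p R, (R / 5) ^ 2 ≤ sphereDistSq p q →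
      Metric.infDist (f q) Z ≤ M * C * η := by
    intro q hqR hqd
    obtain ⟨s, hs, hray⟩ := exists_ray_sphereDistSq_le p q
    obtain ⟨y, hy, z, hz, hyz, hyn⟩ := hC (pseudoResolvent A q (f q))
    obtain ⟨g, hg, h, hh, hgh, -⟩ := hC (f q)
    obtain ⟨k, hk, hkw, hkn, -⟩ := hM q ⟨hqR, hqd⟩ y hy
    have hgk : g - k ∈ Z := by
      refine mem_of_pseudoResolvent_mem hYc hZc hY hZ hs
        (fun t ht hσ => not_lt.2 (hqd.trans (hray t ht)) (hYσ hσ).out) (Y.sub_mem hg hk) ?_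
      have h1 : pseudoResolvent A q (g - k) = z - pseudoResolvent A q h := by
        rw [map_sub, hkw, sub_eq_sub_iff_add_eq_add, ← map_add, hgh, ← hyz, add_comm]
      rw [h1]
      exact Z.sub_mem hz (pseudoResolvent_mem hZ q hh)
    calc Metric.infDist (f q) Z ≤ dist (f q) (g - k + h) :=
          Metric.infDist_le_dist_of_mem (Z.add_mem hgk hh)
      _ = ‖k‖ := by rw [dist_eq_norm, ← hgh]; congr 1; abel
      _ ≤ M * ‖y‖ := hkn
      _ ≤ M * (C * η) := by gcongr; exact hyn.trans (by gcongr; exact hfη q hqR)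
      _ = M * C * η := by ring
  obtain ⟨I, hI, hIq⟩ := exists_slicePoint_eq q
  set c : ℂ := ⟨p.re, ‖p.im‖⟩ with hc
  set w : ℂ := ⟨q.re, ‖q.im‖⟩ with hw
  have hqp : ‖q - p‖ ≤ R / 6 := by rwa [← dist_eq_norm]
  have hqd : sphereDistSq p q ≤ (R / 6) ^ 2 :=
    (sphereDistSq_le p q).trans (by gcongr)
  have hwc : ‖w - c‖ ≤ R / 6 := by
    have h := sphereDistSq_slicePoint hI p (z := w) (Or.inr (norm_nonneg _))
    rw [hIq] at h
    exact le_of_sq_le_sq (h ▸ hqd) (by positivity)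
  -- `R / 2 + R / 6 + R / 6 ≤ R`, passing through `w` and `q`, since `p` need not lie on the slice
  -- of `q`.
  have hsub : ∀ z ∈ Metric.closedBall c (R / 2), slicePoint I z ∈ Metric.closedBall p R := by
    intro z hz
    rw [Metric.mem_closedBall, dist_eq_norm] at hz ⊢
    have h1 : ‖slicePoint I z - q‖ = ‖z - w‖ := by
      conv_lhs => rw [← hIq]
      rw [← slicePoint_sub, norm_slicePoint hI]
    have h2 := norm_sub_le_norm_sub_add_norm_sub (slicePoint I z) q p
    have h3 := norm_sub_le_norm_sub_add_norm_sub z c w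
    rw [norm_sub_rev c w] at h3
    linarith
  have hqZ : Metric.infDist (f q) Z ≤ M * C * η := by
    have h := hf.infDist_le_of_forall_mem_sphere hU Z hZc hI (c := c) (r := R / 2)
      (C := M * C * η) (by positivity) (fun z hz => hUR (hsub z hz)) (fun z hz => ?_) (z := w)
      (by rw [Metric.mem_closedBall, dist_eq_norm]; linarith)
    · rwa [hIq] at h
    · refine hdist _ (hsub z (Metric.sphere_subset_closedBall hz)) ?_
      rw [mem_sphere_iff_norm] at hz
      rw [sphereDistSq_slicePoint hI p, hz]
      · gcongr; norm_num
      -- If `p` is not real, `R ≤ ‖p.im‖` keeps the circle in the upper half-plane.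
      · refine hp.imp_right fun hp => ?_
        have h1 := (abs_le.1 ((Complex.abs_im_le_norm (z - c)).trans_eq hz)).1
        rw [Complex.sub_im] at h1
        change -(R / 2) ≤ z.im - ‖p.im‖ at h1
        linarith
  have hqR : q ∈ Metric.closedBall p R :=
    Metric.closedBall_subset_closedBall (by linarith) hq
  -- The distance to `Z` need not be attained; the slack `η` provides `h`.
  obtain ⟨h, hh, hfh⟩ := (Metric.infDist_lt_iff ⟨0, Z.zero_mem⟩).1
    (hqZ.trans_lt (lt_add_of_pos_right _ hη))
  rw [dist_eq_norm] at hfh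
  obtain ⟨y, -, -, hyn, hyu⟩ := hM' q ⟨hqR, hqd⟩ _ (pseudoResolvent_mem hZ q hh)
  -- By uniqueness the preimage of `R_q(A) h` in `Z` is `h`, so its bound applies to `h`.
  rw [← hyu h hh rfl] at hyn
  have hRh : ‖pseudoResolvent A q h‖ ≤ η + N * (M * C * η + η) := by
    have h1 : pseudoResolvent A q h = pseudoResolvent A q (f q) - pseudoResolvent A q (f q - h) := by
      rw [map_sub, sub_sub_cancel]
    rw [h1]
    refine (norm_sub_le _ _).trans (add_le_add (hfη q hqR) ?_)
    rw [← quadratic_restrictScalars_apply]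
    exact ((quadratic (A.restrictScalars ℝ) q).le_of_opNorm_le (hN q hqR) _).trans (by gcongr)
  calc ‖f q‖ = ‖(f q - h) + h‖ := by rw [sub_add_cancel]
    _ ≤ (M * C * η + η) + M' * (η + N * (M * C * η + η)) :=
        (norm_add_le _ _).trans (add_le_add hfh.le (hyn.trans (by gcongr)))
    _ = (M * C + 1 + M' * (1 + N * (M * C + 1))) * η := by ring

end Decomposition

end QuaternionicOperator

/-! ### Bishop's property -/

theorem theorem1p2p7 {V : Type*} [NormedAddCommGroup V] [NormedSpace ℝ V] [CompleteSpace V]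
    [Module (Quaternion ℝ)ᵐᵒᵖ V] [IsScalarTower ℝ (Quaternion ℝ)ᵐᵒᵖ V]
    [NormSMulClass (Quaternion ℝ)ᵐᵒᵖ V]
    (A : V →L[(Quaternion ℝ)ᵐᵒᵖ] V) (hA : QuaternionicOperator.IsDecomposable A) :
    QuaternionicOperator.HasBishopProperty A := by
  intro U hU f hf hlim
  rw [Metric.tendstoLocallyUniformlyOn_iff]
  intro ε hε p hp
  obtain ⟨r, hr, hrU⟩ := Metric.nhds_basis_closedBall.mem_iff.1 (hU.mem_nhds hp)
  obtain ⟨R, hR, hRr, hRp⟩ : ∃ R : ℝ, 0 < R ∧ R ≤ r ∧ (‖p.im‖ = 0 ∨ R ≤ ‖p.im‖) := by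
    rcases (norm_nonneg p.im).eq_or_lt with h | h
    · exact ⟨r, hr, le_rfl, Or.inl h.symm⟩
    · exact ⟨min r ‖p.im‖, lt_min hr h, min_le_left _ _, Or.inr (min_le_right _ _)⟩
  have hRU := (Metric.closedBall_subset_closedBall hRr).trans hrU
  obtain ⟨B, hB, hBf⟩ := hA.exists_norm_le p hR hRp
  -- `B + 1` avoids division by zero and makes the final inequality strict.
  have hη : 0 < ε / (B + 1) := by positivity
  refine ⟨Metric.closedBall p (R / 6),
    mem_nhdsWithin_of_mem_nhds (Metric.closedBall_mem_nhds p (by positivity)), ?_⟩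
  filter_upwards [Metric.tendstoUniformlyOn_iff.1 (hlim _ hRU (isCompact_closedBall p R)) _ hη]
    with n hn q hq
  have h := hBf U hU hRU (f n) (hf n).2 _ hη
    (fun q hq => by simpa using (hn q hq).le) q hq
  have hlt : B * (ε / (B + 1)) < ε := by
    rw [← mul_div_assoc, div_lt_iff₀ (by positivity)]
    linarith
  simpa using h.trans_lt hlt
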